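/- Let $0<\alpha<2$, $-1\le\beta\le1$, $\gamma>0$, $\delta\in\mathbb R$. Put $$\eta(u,\alpha)=\begin{cases}-(\operatorname{sign}u)\tan(\pi\alpha/2)\,|u|^\alpha,&\alpha\ne1,\\ (2/\pi)\,u\ln|u|,&\alpha=1,\end{cases}\qquad \delta^*=\begin{cases}\delta/\gamma,&\alpha\neq1,\\ \delta/\gamma+(2/\pi)\beta\ln\gamma,&\alpha=1,\end{cases}$$ and for real $x$ and $d$ $$g_d(x|\alpha,\beta)=\begin{cases}\int_0^\infty\cos(xr+\beta\eta(r,\alpha))\,r^{d-1}e^{-r^\alpha}\,dr,&d>0,\\[2pt] \int_0^\infty[\cos(xr+\beta\eta(r,\alpha))-1]\,r^{d-1}e^{-r^\alpha}\,dr,&-2\min(1,\alpha)<d\le0,\end{cases}$$ $$\tilde g_d(x|\alpha,\beta)=\begin{cases}\int_0^\infty\sin(xr+\beta\eta(r,\alpha))\,r^{d-1}e^{-r^\alpha}\,dr,&d>-\min(1,\alpha),\\[2pt] \int_0^\infty[\sin(xr+\beta\eta(r,\alpha))-xr]\,r^{d-1}e^{-r^\alpha}\,dr,&\alpha>1,\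 -\alpha<d\le-1.\end{cases}$$ Let $X$ be a stable random variable with characteristic function $$E e^{iuX}=\exp\left(-\gamma^\alpha\left[|u|^\alpha+i\beta\,\eta(u,\alpha)\right]+iu\delta\right),\qquad u\in\mathbb R,$$ and write $x^{\langle p\rangle}=\operatorname{sign}(x)|x|^p$. Let $-1<p<\alpha$. Then the integrals defining $g_{-p}(-\delta^*|\alpha,\beta)$ and $\tilde g_{-p}(-\delta^*|\alpha,\beta)$ converge absolutely, $E|X|^p<\infty$, and $$E|X|^p=\gamma^p\,\frac{2\Gamma(p+1)}{\pi}\,\sin\left(\frac{\pi p}{2}\right)\left(\frac{\Gamma(1-p/\alpha)}{p}\,\mathbf 1_{\{p>0\}}-g_{-p}(-\delta^*|\alpha,\beta)\right)\qquad(p\ne0),$$ $$E X^{\langle p\rangle}=\gamma^p\,\frac{2\Gamma(p+1)}{\pi}\,\cos\left(\frac{\pi p}{2}\right)\left(\frac{\delta^*\,\Gamma((1-p)/\alpha)}{\alpha}\,\mathbf 1_{\{p>1\}}-\tilde g_{-p}(-\delta^*|\alpha,\beta)\right)\qquad(p\ne1).$$ At the two excluded values the right-hand sides are to be read as limits: $E|X|^0=1$,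 and the right-hand side of the first formula tends to $1$ as $p\to0$, $p\neq 0$; and if $\alpha>1$, then $E X^{\langle1\rangle}=EX=\delta$, and the right-hand side of the second formula tends to $\delta$ as $p\to1$, $p\neq 1$. -/

import Mathlib

open MeasureTheory Set Filter Topology

noncomputable section

/-- The function `η(u, α)` in the exponent of the stable characteristic function:
`-(sign u) tan(πα/2) |u|^α` if `α ≠ 1`, and `(2/π) u log |u|` if `α = 1`. -/
def stableEta (u α : ℝ) : ℝ :=
  if α = 1 then (2 / Real.pi) * u * Real.log |u|
  else -(Real.sign u) * Real.tan (Real.pi * α / 2) * |u| ^ α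

/-- The characteristic function of the stable law with index `α`, skewness `β`, scale `γ` and
location `δ`: `exp(-γ^α [|u|^α + i β η(u, α)] + i u δ)`. -/
def stableCharFun (α β γ δ u : ℝ) : ℂ :=
  Complex.exp (-((γ ^ α : ℝ) : ℂ) * (((|u| ^ α : ℝ) : ℂ)
      + Complex.I * (β : ℂ) * ((stableEta u α : ℝ) : ℂ))
    + Complex.I * (u : ℂ) * (δ : ℂ))

/-- `X` is a random variable on `(Ω, P)` with the stable law `S(α, β, γ, δ; 1)`. -/
structure HasStableLaw {Ω : Type*} [MeasurableSpace Ω] (X : Ω → ℝ) (P : Measure Ω)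
    (α β γ δ : ℝ) : Prop where
  aemeasurable : AEMeasurable X P
  charFun_eq : ∀ u : ℝ, charFun (P.map X) u = stableCharFun α β γ δ u

/-- The integrand of `g_d(x | α, β)`. -/
def gIntegrand (α β d x r : ℝ) : ℝ :=
  if 0 < d then
    Real.cos (x * r + β * stableEta r α) * r ^ (d - 1) * Real.exp (-r ^ α)
  else
    (Real.cos (x * r + β * stableEta r α) - 1) * r ^ (d - 1) * Real.exp (-r ^ α)

/-- The function `g_d(x | α, β)`; it is used for `d > -2 min(1, α)`. -/
def gFun (α β d x : ℝ) : ℝ := ∫ r in Ioi (0 : ℝ), gIntegrand α β d x r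

/-- The integrand of `g̃_d(x | α, β)`. -/
def gtIntegrand (α β d x r : ℝ) : ℝ :=
  if -(min 1 α) < d then
    Real.sin (x * r + β * stableEta r α) * r ^ (d - 1) * Real.exp (-r ^ α)
  else
    (Real.sin (x * r + β * stableEta r α) - x * r) * r ^ (d - 1) * Real.exp (-r ^ α)

/-- The function `g̃_d(x | α, β)`; it is used for `d > -min(1, α)`, and also for
`-α < d ≤ -1` if `α > 1`. -/
def gtFun (α β d x : ℝ) : ℝ := ∫ r in Ioi (0 : ℝ), gtIntegrand α β d x r

/-- The normalized location `δ*`. -/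
def deltaStar (α β γ δ : ℝ) : ℝ :=
  if α = 1 then δ / γ + (2 / Real.pi) * β * Real.log γ else δ / γ

/-- The signed power `x^{<p>} = sign(x) |x|^p`. -/
def signedPow (x p : ℝ) : ℝ := Real.sign x * |x| ^ p

/-- The closed expression for the absolute moment of order `p`. -/
def absMomentExpr (α β γ δ p : ℝ) : ℝ :=
  γ ^ p * (2 * Real.Gamma (p + 1) / Real.pi) * Real.sin (Real.pi * p / 2) *
    ((if 0 < p then Real.Gamma (1 - p / α) / p else 0)
      - gFun α β (-p) (-deltaStar α β γ δ))

/-- The closed expression for the signed moment of order `p`. -/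
def signedMomentExpr (α β γ δ p : ℝ) : ℝ :=
  γ ^ p * (2 * Real.Gamma (p + 1) / Real.pi) * Real.cos (Real.pi * p / 2) *
    ((if 1 < p then deltaStar α β γ δ * Real.Gamma ((1 - p) / α) / α else 0)
      - gtFun α β (-p) (-deltaStar α β γ δ))

end

/-! Every moment is read off the characteristic function φ of a law μ by a Laplace transform
followed by a Mellin transform. For t > 0, Fubini gives ∫₀^∞ φ(r) e^{-rt} dr = ∫ (t + iz)/(t² + z²)
dμ(z) (`laplace_charFun`). Integrate suitable real or imaginary parts against t^p dt. On the r side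
the t-integral is Γ(p+1) r^{-p-1} (`integral_rpow_mul_laplace`). On the z side the kernel
t^{a-1}/(t² + z²) integrates to |z|^{a-2} π/(2 sin(πa/2)) for 0 < a < 2
(`integral_rpow_div_sq_add_sq`), so a power of z comes out.

The shift a depends on the range of p: Re φ with p < 0 uses a = p+2, 1 - Re φ with p > 0 uses a = p,
Im φ with p < 1 uses a = p+1, and (mean)·r - Im φ with p > 1 uses a = p-1. For absolute moments the
kernel is nonnegative, so Tonelli also yields their finiteness; this then licenses Fubini for the
signed ones.

For X/γ one has φ(r) = exp(-r^α - iθ(r)) for r > 0, with θ the phase at x = -δ*. Hence the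
r-integrals are g and g̃ up to ∫₀^∞ (1 - e^{-r^α}) r^{-p-1} dr (`integral_one_sub_exp_neg_rpow`),
which produces the Gamma terms. Bounds on θ near 0 give absolute convergence. The limits at p = 0
and p = 1 are those of the moments themselves, by dominated convergence. -/

/-! ### Two Mellin integrals. -/

theorem integrable_uncurry_of_nonneg {A B : Type*} [MeasurableSpace A] [MeasurableSpace B]
    {μ : Measure A} {ν : Measure B} [SFinite ν] {f : A → B → ℝ}
    (hf : AEStronglyMeasurable (Function.uncurry f) (μ.prod ν))
    (h0 : ∀ᵐ x ∂μ, ∀ᵐ y ∂ν, 0 ≤ f x y) (h1 : ∀ᵐ x ∂μ, Integrable (f x) ν)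
    (h2 : Integrable (fun x => ∫ y, f x y ∂ν) μ) :
    Integrable (Function.uncurry f) (μ.prod ν) := by
  rw [integrable_prod_iff hf]
  refine ⟨h1, h2.congr ?_⟩
  filter_upwards [h0] with x hx
  refine integral_congr_ae ?_
  filter_upwards [hx] with y hy
  simp [Function.uncurry, abs_of_nonneg hy]

/-- The integral `∫₀^∞ t^(a-1) / (t² + z²) dt` for `0 < a < 2`. -/
theorem integral_rpow_div_sq_add_sq {a z : ℝ} (ha0 : 0 < a) (ha2 : a < 2) (hz : z ≠ 0) :
    IntegrableOn (fun t => t ^ (a - 1) / (t ^ 2 + z ^ 2)) (Ioi 0) ∧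
      ∫ t in Ioi (0 : ℝ), t ^ (a - 1) / (t ^ 2 + z ^ 2)
        = |z| ^ (a - 2) * (Real.pi / (2 * Real.sin (Real.pi * a / 2))) := by
  have hz2 : 0 < z ^ 2 := by positivity
  -- Write 1/(t² + z²) as ∫₀^∞ e^{-(t² + z²)y} dy. Integrating in t first leaves Γ(a/2) Γ(1 - a/2),
  -- and the reflection formula gives the sine.
  let f : ℝ → ℝ → ℝ := fun y t => t ^ (a - 1) * Real.exp (-y * t ^ (2 : ℝ)) * Real.exp (-(z ^ 2 * y))
  have hf : Measurable (Function.uncurry f) := by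
    unfold f Function.uncurry; fun_prop
  have hslice : ∀ y ∈ Ioi (0 : ℝ), ∫ t in Ioi (0 : ℝ), f y t
      = (1 / 2) * Real.Gamma (a / 2) * (y ^ ((1 - a / 2) - 1) * Real.exp (-(z ^ 2 * y))) := by
    intro y hy
    simp only [f]
    rw [integral_mul_const, integral_rpow_mul_exp_neg_mul_rpow two_pos (by linarith) hy]
    rw [show -(a - 1 + 1) / 2 = (1 - a / 2) - 1 by ring, show (a - 1 + 1) / 2 = a / 2 by ring]
    ring
  have hI : Integrable (Function.uncurry f)
      ((volume.restrict (Ioi (0 : ℝ))).prod (volume.restrict (Ioi (0 : ℝ)))) := by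
    refine integrable_uncurry_of_nonneg hf.aestronglyMeasurable ?_ ?_ ?_
    · filter_upwards with y
      filter_upwards [ae_restrict_mem measurableSet_Ioi] with t ht
      have := mem_Ioi.1 ht
      positivity
    · filter_upwards [ae_restrict_mem measurableSet_Ioi] with y hy
      exact (integrableOn_rpow_mul_exp_neg_mul_rpow (by linarith) two_pos hy).mul_const _
    · refine Integrable.congr (f := fun y => (1 / 2) * Real.Gamma (a / 2) *
        (y ^ ((1 - a / 2) - 1) * Real.exp (-(z ^ 2 * y)))) ?_ ?_
      · refine Integrable.const_mul ?_ _
        have := integrableOn_rpow_mul_exp_neg_mul_rpow (p := 1) (s := (1 - a / 2) - 1) (b := z ^ 2)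
          (by linarith) one_pos hz2
        simpa [IntegrableOn, neg_mul] using this
      · filter_upwards [ae_restrict_mem measurableSet_Ioi] with y hy
        exact (hslice y hy).symm
  have hslice' : ∀ t ∈ Ioi (0 : ℝ), ∫ y in Ioi (0 : ℝ), f y t = t ^ (a - 1) / (t ^ 2 + z ^ 2) := by
    intro t ht
    have h1 : 0 < t ^ 2 + z ^ 2 := by positivity
    have : ∀ y, f y t = t ^ (a - 1) * Real.exp (-(t ^ 2 + z ^ 2) * y) := by
      intro y
      simp only [f]
      rw [mul_assoc, ← Real.exp_add, Real.rpow_two]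
      congr 2; ring
    simp_rw [this]
    rw [integral_const_mul, integral_exp_mul_Ioi (by linarith)]
    simp only [mul_zero, Real.exp_zero]
    rw [neg_div_neg_eq, mul_one_div]
  constructor
  · refine Integrable.congr hI.integral_prod_right ?_
    filter_upwards [ae_restrict_mem measurableSet_Ioi] with t ht
    exact hslice' t ht
  · rw [← setIntegral_congr_fun measurableSet_Ioi hslice', ← integral_integral_swap hI,
      setIntegral_congr_fun measurableSet_Ioi hslice, integral_const_mul,
      Real.integral_rpow_mul_exp_neg_mul_Ioi (by linarith) hz2]
    have h1 := Real.Gamma_mul_Gamma_one_sub (a / 2)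
    have h2 : (1 / z ^ 2) ^ (1 - a / 2) = |z| ^ (a - 2) := by
      rw [one_div, Real.inv_rpow hz2.le, ← Real.rpow_neg hz2.le, ← sq_abs, ← Real.rpow_two,
        ← Real.rpow_mul (abs_nonneg z)]
      congr 1; ring
    rw [h2, show 1 / 2 * Real.Gamma (a / 2) * (|z| ^ (a - 2) * Real.Gamma (1 - a / 2))
      = |z| ^ (a - 2) * (1 / 2 * (Real.Gamma (a / 2) * Real.Gamma (1 - a / 2))) by ring, h1,
      show Real.pi * (a / 2) = Real.pi * a / 2 by ring]
    congr 1
    rw [div_mul_div_comm, one_mul]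

/-- The Mellin transform in `t` of the Laplace transform of `h`. -/
theorem integral_rpow_mul_laplace {p : ℝ} (hp : -1 < p) {h : ℝ → ℝ}
    (hh : IntegrableOn (fun r => h r * r ^ (-p - 1)) (Ioi 0)) :
    IntegrableOn (fun t => t ^ p * ∫ r in Ioi (0 : ℝ), h r * Real.exp (-(r * t))) (Ioi 0) ∧
      ∫ t in Ioi (0 : ℝ), t ^ p * ∫ r in Ioi (0 : ℝ), h r * Real.exp (-(r * t))
        = Real.Gamma (p + 1) * ∫ r in Ioi (0 : ℝ), h r * r ^ (-p - 1) := by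
  let k : ℝ → ℝ := fun r => h r * r ^ (-p - 1)
  -- The factor r^{p+1} is split off so that what multiplies k(r) has t-integral Γ(p+1) for every r;
  -- joint integrability then reduces to that of k.
  let f : ℝ → ℝ → ℝ := fun r t => k r * (r ^ (p + 1) * (t ^ p * Real.exp (-(r * t))))
  have hkey : ∀ r ∈ Ioi (0 : ℝ), ∀ t, f r t = t ^ p * (h r * Real.exp (-(r * t))) := by
    intro r hr t
    simp only [f, k]
    have : r ^ (-p - 1) * r ^ (p + 1) = 1 := by
      rw [← Real.rpow_add hr]; simp
    linear_combination (h r * t ^ p * Real.exp (-(r * t))) * this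
  have hint : ∀ r ∈ Ioi (0 : ℝ), ∫ t in Ioi (0 : ℝ), r ^ (p + 1) * (t ^ p * Real.exp (-(r * t)))
      = Real.Gamma (p + 1) := by
    intro r hr
    have hr0 : 0 < r := hr
    have := Real.integral_rpow_mul_exp_neg_mul_Ioi (a := p + 1) (r := r) (by linarith) hr
    rw [add_sub_cancel_right] at this
    rw [integral_const_mul, this, ← mul_assoc, ← Real.mul_rpow hr0.le (by positivity)]
    simp [hr0.ne']
  have hslint : ∀ r ∈ Ioi (0 : ℝ),
      IntegrableOn (fun t => r ^ (p + 1) * (t ^ p * Real.exp (-(r * t)))) (Ioi 0) := by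
    intro r hr
    have := integrableOn_rpow_mul_exp_neg_mul_rpow (p := 1) (s := p) (b := r) hp one_pos hr
    simp only [Real.rpow_one, neg_mul] at this
    exact this.const_mul _
  have hI : Integrable (Function.uncurry f)
      ((volume.restrict (Ioi (0 : ℝ))).prod (volume.restrict (Ioi (0 : ℝ)))) := by
    have hm : AEStronglyMeasurable (Function.uncurry f)
        ((volume.restrict (Ioi (0 : ℝ))).prod (volume.restrict (Ioi (0 : ℝ)))) := by
      refine AEStronglyMeasurable.mul (f := fun x : ℝ × ℝ => k x.1)
        (hh.aestronglyMeasurable.comp_fst) ?_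
      refine Measurable.aestronglyMeasurable ?_
      fun_prop
    rw [integrable_prod_iff hm]
    constructor
    · filter_upwards [ae_restrict_mem measurableSet_Ioi] with r hr
      exact (hslint r hr).const_mul (k r)
    · refine Integrable.congr (hh.norm.mul_const (Real.Gamma (p + 1))) ?_
      filter_upwards [ae_restrict_mem measurableSet_Ioi] with r hr
      rw [← hint r hr, ← integral_const_mul]
      refine setIntegral_congr_fun measurableSet_Ioi fun t ht => ?_
      have hr0 : 0 < r := hr
      have ht0 : 0 < t := ht
      simp only [Function.uncurry, f, k]
      rw [norm_mul (h r * r ^ (-p - 1))]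
      congr 1
      rw [Real.norm_of_nonneg (by positivity)]
  have hslice' : ∀ t ∈ Ioi (0 : ℝ), ∫ r in Ioi (0 : ℝ), f r t
      = t ^ p * ∫ r in Ioi (0 : ℝ), h r * Real.exp (-(r * t)) := by
    intro t _
    rw [← integral_const_mul]
    exact setIntegral_congr_fun measurableSet_Ioi fun r hr => hkey r hr t
  constructor
  · refine Integrable.congr hI.integral_prod_right ?_
    filter_upwards [ae_restrict_mem measurableSet_Ioi] with t ht
    exact hslice' t ht
  · rw [← setIntegral_congr_fun measurableSet_Ioi hslice', ← integral_integral_swap hI,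
      ← integral_const_mul]
    refine setIntegral_congr_fun measurableSet_Ioi fun r hr => ?_
    simp only [f]
    rw [integral_const_mul, hint r hr, mul_comm]

/-! ### Laplace transforms of characteristic functions. -/

theorem integrable_charFun_mul_exp (μ : Measure ℝ) [IsProbabilityMeasure μ] {t : ℝ} (ht : 0 < t) :
    IntegrableOn (fun r : ℝ => charFun μ r * Complex.exp (-(r * t))) (Ioi 0) := by
  refine Integrable.mono' (exp_neg_integrableOn_Ioi 0 ht) ?_ ?_
  · exact (Measurable.aestronglyMeasurable
      (by have := (stronglyMeasurable_charFun (μ := μ)).measurable; fun_prop))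
  · filter_upwards with r
    rw [norm_mul, Complex.norm_exp]
    have := norm_charFun_le_one (μ := μ) r
    calc _ ≤ 1 * Real.exp (-(r * t) : ℂ).re := by gcongr
      _ = _ := by simp [mul_comm]

/-- The Laplace transform of the characteristic function of `μ` on the half-line. -/
theorem laplace_charFun (μ : Measure ℝ) [IsProbabilityMeasure μ] {t : ℝ} (ht : 0 < t) :
    ∫ r in Ioi (0 : ℝ), charFun μ r * Complex.exp (-(r * t))
      = ∫ z, ((t / (t ^ 2 + z ^ 2) : ℝ) + (z / (t ^ 2 + z ^ 2) : ℝ) * Complex.I : ℂ) ∂μ := by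
  let f : ℝ → ℝ → ℂ := fun r z => Complex.exp ((z * Complex.I - t) * r)
  have hI : Integrable (Function.uncurry f) ((volume.restrict (Ioi (0 : ℝ))).prod μ) := by
    have h1 : Integrable (fun x : ℝ × ℝ => Real.exp (-t * x.1))
        ((volume.restrict (Ioi (0 : ℝ))).prod μ) :=
      (exp_neg_integrableOn_Ioi 0 ht).comp_fst μ
    refine h1.mono' (Measurable.aestronglyMeasurable ?_) ?_
    · unfold f Function.uncurry; fun_prop
    · filter_upwards with x
      simp [f, Function.uncurry, Complex.norm_exp]
  have h1 : ∀ r : ℝ, charFun μ r * Complex.exp (-(r * t)) = ∫ z, f r z ∂μ := by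
    intro r
    rw [charFun_apply_real, ← integral_mul_const]
    refine integral_congr_ae (ae_of_all _ fun z => ?_)
    simp only [f]
    rw [← Complex.exp_add]; congr 1; ring
  simp_rw [h1]
  rw [integral_integral_swap hI]
  refine integral_congr_ae (ae_of_all _ fun z => ?_)
  simp only [f]
  have hre : (z * Complex.I - t : ℂ).re < 0 := by simpa using ht
  have hne : (z * Complex.I - t : ℂ) ≠ 0 := fun h => by rw [h] at hre; simp at hre
  have hne2 : (t ^ 2 + z ^ 2 : ℂ) ≠ 0 := by
    have : t ^ 2 + z ^ 2 ≠ 0 := by positivity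
    exact_mod_cast this
  rw [integral_exp_mul_complex_Ioi hre]
  push_cast
  simp only [mul_zero, Complex.exp_zero]
  field_simp
  ring_nf
  simp [Complex.I_sq]
  ring

theorem integrable_const_div_sq_add_sq (μ : Measure ℝ) [IsProbabilityMeasure μ] {t : ℝ}
    (ht : 0 < t) : Integrable (fun z => t / (t ^ 2 + z ^ 2)) μ := by
  refine Integrable.of_bound (C := 1 / t) (Measurable.aestronglyMeasurable (by fun_prop)) ?_
  filter_upwards with z
  rw [Real.norm_of_nonneg (by positivity), div_le_div_iff₀ (by positivity) ht]
  nlinarith [sq_nonneg z]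

theorem integrable_id_div_sq_add_sq (μ : Measure ℝ) [IsProbabilityMeasure μ] {t : ℝ}
    (ht : 0 < t) : Integrable (fun z => z / (t ^ 2 + z ^ 2)) μ := by
  refine Integrable.of_bound (C := 1 / t) (Measurable.aestronglyMeasurable (by fun_prop)) ?_
  filter_upwards with z
  rw [Real.norm_eq_abs, abs_div, abs_of_pos (show 0 < t ^ 2 + z ^ 2 by positivity),
    div_le_div_iff₀ (by positivity) ht, ← sq_abs z]
  nlinarith [sq_nonneg (t - |z|), mul_nonneg ht.le (abs_nonneg z)]

theorem laplace_re_charFun (μ : Measure ℝ) [IsProbabilityMeasure μ] {t : ℝ} (ht : 0 < t) :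
    IntegrableOn (fun r => (charFun μ r).re * Real.exp (-(r * t))) (Ioi 0) ∧
    ∫ r in Ioi (0 : ℝ), (charFun μ r).re * Real.exp (-(r * t)) = ∫ z, t / (t ^ 2 + z ^ 2) ∂μ := by
  have h := congrArg Complex.re (laplace_charFun μ ht)
  have e : ∀ r : ℝ, (charFun μ r * Complex.exp (-(r * t))).re
      = (charFun μ r).re * Real.exp (-(r * t)) := by
    intro r
    rw [show (-(r * t) : ℂ) = ((-(r * t) : ℝ) : ℂ) by push_cast; ring, ← Complex.ofReal_exp,
      Complex.re_mul_ofReal]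
  have hi := integrable_charFun_mul_exp μ ht
  have hj : Integrable (fun z : ℝ => ((t / (t ^ 2 + z ^ 2) : ℝ) +
      (z / (t ^ 2 + z ^ 2) : ℝ) * Complex.I : ℂ)) μ :=
    (integrable_const_div_sq_add_sq μ ht).ofReal.add
      ((integrable_id_div_sq_add_sq μ ht).ofReal.mul_const _)
  have h1 := integral_re hi
  have h2 := integral_re hj
  simp only [RCLike.re_eq_complex_re] at h1 h2
  rw [← h1, ← h2] at h
  simp only [e] at h
  refine ⟨hi.re.congr (ae_of_all _ fun r => e r), h.trans (integral_congr_ae (ae_of_all _ fun z => ?_))⟩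
  simp only [Complex.add_re, Complex.re_ofReal_mul, Complex.ofReal_re, Complex.I_re, mul_zero,
    add_zero]

theorem laplace_im_charFun (μ : Measure ℝ) [IsProbabilityMeasure μ] {t : ℝ} (ht : 0 < t) :
    IntegrableOn (fun r => (charFun μ r).im * Real.exp (-(r * t))) (Ioi 0) ∧
    ∫ r in Ioi (0 : ℝ), (charFun μ r).im * Real.exp (-(r * t)) = ∫ z, z / (t ^ 2 + z ^ 2) ∂μ := by
  have h := congrArg Complex.im (laplace_charFun μ ht)
  have e : ∀ r : ℝ, (charFun μ r * Complex.exp (-(r * t))).im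
      = (charFun μ r).im * Real.exp (-(r * t)) := by
    intro r
    rw [show (-(r * t) : ℂ) = ((-(r * t) : ℝ) : ℂ) by push_cast; ring, ← Complex.ofReal_exp,
      Complex.im_mul_ofReal]
  have hi := integrable_charFun_mul_exp μ ht
  have hj : Integrable (fun z : ℝ => ((t / (t ^ 2 + z ^ 2) : ℝ) +
      (z / (t ^ 2 + z ^ 2) : ℝ) * Complex.I : ℂ)) μ :=
    (integrable_const_div_sq_add_sq μ ht).ofReal.add
      ((integrable_id_div_sq_add_sq μ ht).ofReal.mul_const _)
  have h1 := integral_im hi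
  have h2 := integral_im hj
  simp only [RCLike.im_eq_complex_im] at h1 h2
  rw [← h1, ← h2] at h
  simp only [e] at h
  refine ⟨hi.im.congr (ae_of_all _ fun r => e r), h.trans (integral_congr_ae (ae_of_all _ fun z => ?_))⟩
  simp only [Complex.add_im, Complex.im_ofReal_mul, Complex.ofReal_im, Complex.I_im, mul_one,
    zero_add]

/-! ### Signed powers. -/

theorem measurable_realSign : Measurable Real.sign := by
  unfold Real.sign
  exact Measurable.ite measurableSet_Iio measurable_const
    (Measurable.ite measurableSet_Ioi measurable_const measurable_const)

theorem measurable_signedPow (p : ℝ) : Measurable (fun x => signedPow x p) := by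
  have := measurable_realSign
  unfold signedPow
  fun_prop

theorem abs_signedPow_le (x p : ℝ) : |signedPow x p| ≤ |x| ^ p := by
  unfold signedPow
  have : 0 ≤ |x| ^ p := by positivity
  rw [abs_mul, abs_of_nonneg this]
  rcases Real.sign_apply_eq x with h | h | h <;> simp [h, this]

theorem integrable_signedPow {μ : Measure ℝ} {p : ℝ} (h : Integrable (fun z => |z| ^ p) μ) :
    Integrable (fun z => signedPow z p) μ :=
  h.mono' (measurable_signedPow p).aestronglyMeasurable (ae_of_all _ fun z => abs_signedPow_le z p)

theorem mul_abs_rpow_eq_signedPow (z p : ℝ) : z * |z| ^ (p - 1) = signedPow z p := by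
  unfold signedPow
  rcases eq_or_ne z 0 with rfl | hz
  · simp
  · rw [Real.rpow_sub_one (abs_ne_zero.2 hz)]
    have : Real.sign z * |z| = z := by
      rcases hz.lt_or_gt with h | h
      · simp [Real.sign_of_neg h, abs_of_neg h]
      · simp [Real.sign_of_pos h, abs_of_pos h]
    have h2 : |z| ≠ 0 := abs_ne_zero.2 hz
    field_simp
    linear_combination -this

theorem pow_three_mul_abs_rpow_eq_signedPow (z p : ℝ) :
    z ^ 3 * |z| ^ (p - 3) = signedPow z p := by
  rw [← mul_abs_rpow_eq_signedPow]
  rcases eq_or_ne z 0 with rfl | hz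
  · simp
  · rw [show p - 1 = (p - 3) + (2 : ℕ) by push_cast; ring,
      Real.rpow_add_natCast (abs_ne_zero.2 hz), sq_abs]
    ring

/-! ### Exchanging the kernel integral with the law. -/

/-- Fubini for the kernel `t^(a-1) w(z) / (t² + z²)` with a nonnegative weight. -/
theorem integrable_kernel_of_nonneg (μ : Measure ℝ) [IsProbabilityMeasure μ] {a : ℝ} {w : ℝ → ℝ}
    (hw : Measurable w) (hw0 : ∀ z, 0 ≤ w z)
    (hint : ∀ t > 0, Integrable (fun z => w z / (t ^ 2 + z ^ 2)) μ)
    (hF : IntegrableOn (fun t => t ^ (a - 1) * ∫ z, w z / (t ^ 2 + z ^ 2) ∂μ) (Ioi 0)) :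
    Integrable (Function.uncurry fun t z : ℝ => t ^ (a - 1) * (w z / (t ^ 2 + z ^ 2)))
      ((volume.restrict (Ioi (0 : ℝ))).prod μ) := by
  refine integrable_uncurry_of_nonneg (Measurable.aestronglyMeasurable ?_) ?_ ?_ ?_
  · unfold Function.uncurry; fun_prop
  · filter_upwards [ae_restrict_mem measurableSet_Ioi] with t ht
    filter_upwards with z
    have := hw0 z
    have := mem_Ioi.1 ht
    positivity
  · filter_upwards [ae_restrict_mem measurableSet_Ioi] with t ht
    exact (hint t ht).const_mul _
  · simpa only [integral_const_mul, IntegrableOn] using hF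

/-- At z = 0 the kernel is t^{a-3}, not integrable on the half-line, so the weight has to vanish
there. -/
theorem integral_kernel_slice {a : ℝ} (ha0 : 0 < a) (ha2 : a < 2) (c : ℝ) {z : ℝ}
    (hz : c = 0 ∨ z ≠ 0) :
    IntegrableOn (fun t => t ^ (a - 1) * (c / (t ^ 2 + z ^ 2))) (Ioi 0) ∧
    ∫ t in Ioi (0 : ℝ), t ^ (a - 1) * (c / (t ^ 2 + z ^ 2))
      = c * |z| ^ (a - 2) * (Real.pi / (2 * Real.sin (Real.pi * a / 2))) := by
  rcases hz with rfl | hz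
  · simp
  · obtain ⟨h1, h2⟩ := integral_rpow_div_sq_add_sq ha0 ha2 hz
    have e : ∀ t, t ^ (a - 1) * (c / (t ^ 2 + z ^ 2)) = c * (t ^ (a - 1) / (t ^ 2 + z ^ 2)) :=
      fun t => by ring
    simp_rw [e]
    refine ⟨h1.const_mul c, ?_⟩
    rw [integral_const_mul, h2, mul_assoc]

theorem sin_pi_mul_div_two_pos {a : ℝ} (ha0 : 0 < a) (ha2 : a < 2) :
    0 < Real.sin (Real.pi * a / 2) := by
  have := Real.pi_pos
  apply Real.sin_pos_of_pos_of_lt_pi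
  · positivity
  · nlinarith

/-- Fubini for the kernel `t^(a-1) w(z) / (t² + z²)` with an integrable weight. -/
theorem integral_kernel_swap (μ : Measure ℝ) [IsProbabilityMeasure μ] {a : ℝ} (ha0 : 0 < a)
    (ha2 : a < 2) {w : ℝ → ℝ} (hw : Measurable w) (hw0 : w 0 = 0)
    (hint : Integrable (fun z => w z * |z| ^ (a - 2)) μ) :
    ∫ t in Ioi (0 : ℝ), t ^ (a - 1) * ∫ z, w z / (t ^ 2 + z ^ 2) ∂μ
      = (∫ z, w z * |z| ^ (a - 2) ∂μ) * (Real.pi / (2 * Real.sin (Real.pi * a / 2))) := by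
  have hz : ∀ z, w z = 0 ∨ z ≠ 0 := fun z => by
    rcases eq_or_ne z 0 with rfl | h
    · exact Or.inl hw0
    · exact Or.inr h
  have hm : Measurable
      (Function.uncurry fun z t : ℝ => t ^ (a - 1) * (w z / (t ^ 2 + z ^ 2))) := by
    unfold Function.uncurry; fun_prop
  have hI : Integrable (Function.uncurry fun z t : ℝ => t ^ (a - 1) * (w z / (t ^ 2 + z ^ 2)))
      (μ.prod (volume.restrict (Ioi (0 : ℝ)))) := by
    rw [integrable_prod_iff hm.aestronglyMeasurable]
    constructor
    · filter_upwards with z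
      exact (integral_kernel_slice ha0 ha2 (w z) (hz z)).1
    · refine (hint.norm.mul_const (Real.pi / (2 * Real.sin (Real.pi * a / 2)))).congr ?_
      filter_upwards with z
      have h := (integral_kernel_slice ha0 ha2 |w z| (z := z) (by simpa using hz z)).2
      rw [norm_mul, Real.norm_eq_abs, Real.norm_of_nonneg (by positivity : 0 ≤ |z| ^ (a - 2)), ← h]
      refine setIntegral_congr_fun measurableSet_Ioi fun t ht => ?_
      have ht0 : 0 < t := ht
      simp only [Function.uncurry, Real.norm_eq_abs, abs_mul, abs_div]
      rw [abs_of_pos (by positivity : 0 < t ^ (a - 1)),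
        abs_of_pos (by positivity : 0 < t ^ 2 + z ^ 2)]
  simp_rw [← integral_const_mul]
  rw [← integral_integral_swap hI, ← integral_mul_const]
  exact integral_congr_ae (ae_of_all _ fun z => (integral_kernel_slice ha0 ha2 (w z) (hz z)).2)

/-! ### Moments from a general characteristic function. -/

/-- Absolute moments of negative order from the characteristic function. -/
theorem absMoment_neg_of_charFun (μ : Measure ℝ) [IsProbabilityMeasure μ] {p : ℝ} (hp1 : -1 < p)
    (hp0 : p < 0) (h : IntegrableOn (fun r => (charFun μ r).re * r ^ (-p - 1)) (Ioi 0)) :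
    (∀ᵐ z ∂μ, z ≠ 0) ∧ Integrable (fun z => |z| ^ p) μ ∧
      (∫ z, |z| ^ p ∂μ) * (Real.pi / (2 * Real.sin (Real.pi * (p + 2) / 2)))
        = Real.Gamma (p + 1) * ∫ r in Ioi (0 : ℝ), (charFun μ r).re * r ^ (-p - 1) := by
  obtain ⟨h1, h2⟩ := integral_rpow_mul_laplace hp1 h
  have ha0 : 0 < p + 2 := by linarith
  have ha2 : p + 2 < 2 := by linarith
  -- The numerator t moves into the power, leaving the constant weight 1 and a = p + 2.
  have hL : ∀ t ∈ Ioi (0 : ℝ), t ^ p * ∫ r in Ioi (0 : ℝ), (charFun μ r).re * Real.exp (-(r * t))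
      = t ^ ((p + 2) - 1) * ∫ z, 1 / (t ^ 2 + z ^ 2) ∂μ := by
    intro t ht
    rw [(laplace_re_charFun μ ht).2, show p + 2 - 1 = p + 1 by ring,
      Real.rpow_add_one (ne_of_gt ht), mul_assoc, ← integral_const_mul t]
    simp_rw [mul_one_div]
  have hI := integrable_kernel_of_nonneg μ (a := p + 2) (w := fun _ => 1) measurable_const
    (fun _ => zero_le_one) (fun t ht => by
      have := (integrable_const_div_sq_add_sq μ ht).const_mul t⁻¹
      refine this.congr (ae_of_all _ fun z => ?_)
      have : t ≠ 0 := ne_of_gt ht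
      field_simp) (h1.congr_fun hL measurableSet_Ioi)
  -- Integrability of |z|^p cannot exclude an atom at 0, since `0 ^ p = 0` for p ≠ 0. The kernel
  -- can: its slice at z = 0 is t^{p-1}, which is not integrable.
  have hne : ∀ᵐ z ∂μ, z ≠ 0 := by
    filter_upwards [hI.prod_left_ae] with z hz hz0
    subst hz0
    refine not_integrableOn_Ioi_rpow (p - 1) (IntegrableOn.congr_fun (f := fun t : ℝ =>
      t ^ ((p + 2) - 1) * (1 / (t ^ 2 + 0 ^ 2))) hz (fun t ht => ?_) measurableSet_Ioi)
    have ht0 : 0 < t := ht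
    simp only
    rw [show p + 2 - 1 = (p - 1) + (2 : ℕ) by push_cast; ring, Real.rpow_add_natCast ht0.ne']
    field_simp
    simp
  have hval : ∀ᵐ z ∂μ, ∫ t in Ioi (0 : ℝ), t ^ ((p + 2) - 1) * (1 / (t ^ 2 + z ^ 2))
      = |z| ^ p * (Real.pi / (2 * Real.sin (Real.pi * (p + 2) / 2))) := by
    filter_upwards [hne] with z hz
    rw [(integral_kernel_slice ha0 ha2 1 (Or.inr hz)).2, one_mul, add_sub_cancel_right]
  have hs := sin_pi_mul_div_two_pos ha0 ha2
  have hpi := Real.pi_pos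
  refine ⟨hne, ?_, ?_⟩
  · have := (hI.integral_prod_right.congr hval).mul_const
      (Real.pi / (2 * Real.sin (Real.pi * (p + 2) / 2)))⁻¹
    refine this.congr (ae_of_all _ fun z => ?_)
    exact mul_inv_cancel_right₀ (by positivity) _
  · rw [← h2, setIntegral_congr_fun measurableSet_Ioi hL, ← integral_mul_const,
      ← integral_congr_ae hval, ← integral_integral_swap hI]
    simp_rw [integral_const_mul]

/-- Absolute moments of order in `(0, 2)` from the characteristic function. -/
theorem absMoment_pos_of_charFun (μ : Measure ℝ) [IsProbabilityMeasure μ] {p : ℝ} (hp0 : 0 < p)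
    (hp2 : p < 2) (h : IntegrableOn (fun r => (1 - (charFun μ r).re) * r ^ (-p - 1)) (Ioi 0)) :
    Integrable (fun z => |z| ^ p) μ ∧
      (∫ z, |z| ^ p ∂μ) * (Real.pi / (2 * Real.sin (Real.pi * p / 2)))
        = Real.Gamma (p + 1) * ∫ r in Ioi (0 : ℝ), (1 - (charFun μ r).re) * r ^ (-p - 1) := by
  obtain ⟨h1, h2⟩ := integral_rpow_mul_laplace (by linarith) h
  have hL : ∀ t ∈ Ioi (0 : ℝ),
      t ^ p * ∫ r in Ioi (0 : ℝ), (1 - (charFun μ r).re) * Real.exp (-(r * t))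
      = t ^ (p - 1) * ∫ z, z ^ 2 / (t ^ 2 + z ^ 2) ∂μ := by
    intro t ht
    have ht0 : 0 < t := ht
    obtain ⟨e1, e2⟩ := laplace_re_charFun μ ht
    have e3 : IntegrableOn (fun r => Real.exp (-(r * t))) (Ioi 0) := by
      have := exp_neg_integrableOn_Ioi 0 ht0
      simpa [mul_comm] using this
    have e4 : ∫ r in Ioi (0 : ℝ), Real.exp (-(r * t)) = 1 / t := by
      have := integral_exp_mul_Ioi (neg_lt_zero.2 ht0) 0
      simp only [neg_mul, mul_zero, Real.exp_zero, neg_div_neg_eq] at this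
      simpa [mul_comm] using this
    simp_rw [sub_mul, one_mul]
    rw [integral_sub e3 e1, e2, e4, Real.rpow_sub_one ht0.ne']
    -- The subtraction 1/t - t/(t² + z²) = z²/(t(t² + z²)) creates the weight z², which tames z = 0
    -- and allows p > 0.
    have e5 : ∫ z, z ^ 2 / (t ^ 2 + z ^ 2) ∂μ = t * (1 / t - ∫ z, t / (t ^ 2 + z ^ 2) ∂μ) := by
      have : ∀ z, z ^ 2 / (t ^ 2 + z ^ 2) = 1 - t * (t / (t ^ 2 + z ^ 2)) := fun z => by
        have : t ^ 2 + z ^ 2 ≠ 0 := by positivity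
        field_simp; ring
      simp_rw [this]
      rw [integral_sub (integrable_const _) ((integrable_const_div_sq_add_sq μ ht0).const_mul _),
        integral_const_mul]
      simp; field_simp
    rw [e5]; field_simp
  have hI := integrable_kernel_of_nonneg μ (a := p) (w := fun z => z ^ 2) (by fun_prop)
    (fun z => sq_nonneg z) (fun t ht => by
      refine Integrable.of_bound (C := 1) (Measurable.aestronglyMeasurable (by fun_prop)) ?_
      filter_upwards with z
      rw [Real.norm_of_nonneg (by positivity)]
      exact div_le_one_of_le₀ (by nlinarith [sq_nonneg t]) (by positivity))
      (h1.congr_fun hL measurableSet_Ioi)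
  have hval : ∀ z, ∫ t in Ioi (0 : ℝ), t ^ (p - 1) * (z ^ 2 / (t ^ 2 + z ^ 2))
      = |z| ^ p * (Real.pi / (2 * Real.sin (Real.pi * p / 2))) := by
    intro z
    rw [(integral_kernel_slice hp0 hp2 (z ^ 2) (by
      rcases eq_or_ne z 0 with h | h <;> simp [h])).2]
    congr 1
    rcases eq_or_ne z 0 with rfl | hz
    · simp [Real.zero_rpow hp0.ne']
    · rw [← sq_abs z, ← Real.rpow_natCast, ← Real.rpow_add (abs_pos.2 hz)]
      congr 1; push_cast; ring
  have hs := sin_pi_mul_div_two_pos hp0 hp2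
  have hpi := Real.pi_pos
  refine ⟨?_, ?_⟩
  · have := (hI.integral_prod_right.congr (ae_of_all _ hval)).mul_const
      (Real.pi / (2 * Real.sin (Real.pi * p / 2)))⁻¹
    refine this.congr (ae_of_all _ fun z => ?_)
    exact mul_inv_cancel_right₀ (by positivity) _
  · rw [← h2, setIntegral_congr_fun measurableSet_Ioi hL, ← integral_mul_const,
      ← integral_congr_ae (ae_of_all _ hval), ← integral_integral_swap hI]
    simp_rw [integral_const_mul]

/-- Signed moments of order in `(-1, 1)` from the characteristic function. -/
theorem signedMoment_of_charFun (μ : Measure ℝ) [IsProbabilityMeasure μ] {p : ℝ} (hp1 : -1 < p)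
    (hp2 : p < 1) (hp : Integrable (fun z => |z| ^ p) μ)
    (h : IntegrableOn (fun r => (charFun μ r).im * r ^ (-p - 1)) (Ioi 0)) :
    (∫ z, signedPow z p ∂μ) * (Real.pi / (2 * Real.sin (Real.pi * (p + 1) / 2)))
        = Real.Gamma (p + 1) * ∫ r in Ioi (0 : ℝ), (charFun μ r).im * r ^ (-p - 1) := by
  have e : ∀ z : ℝ, z * |z| ^ ((p + 1) - 2) = signedPow z p := fun z => by
    rw [← mul_abs_rpow_eq_signedPow]; congr 2; ring
  have hS := integral_kernel_swap μ (a := p + 1) (by linarith) (by linarith) (w := fun z => z)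
    measurable_id rfl (by simpa only [e] using integrable_signedPow hp)
  simp only [e] at hS
  rw [← hS, ← (integral_rpow_mul_laplace hp1 h).2]
  refine setIntegral_congr_fun measurableSet_Ioi fun t ht => ?_
  rw [(laplace_im_charFun μ ht).2, add_sub_cancel_right]

/-- Signed moments of order in `(1, 2)` from the characteristic function. -/
theorem signedMoment_of_charFun_of_one_lt (μ : Measure ℝ) [IsProbabilityMeasure μ] {p : ℝ}
    (hp1 : 1 < p) (hp2 : p < 2) (hp : Integrable (fun z => |z| ^ p) μ)
    (hid : Integrable (fun z => z) μ)
    (h : IntegrableOn (fun r => ((∫ z, z ∂μ) * r - (charFun μ r).im) * r ^ (-p - 1)) (Ioi 0)) :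
    (∫ z, signedPow z p ∂μ) * (Real.pi / (2 * Real.sin (Real.pi * (p - 1) / 2)))
        = Real.Gamma (p + 1) *
          ∫ r in Ioi (0 : ℝ), ((∫ z, z ∂μ) * r - (charFun μ r).im) * r ^ (-p - 1) := by
  have e : ∀ z : ℝ, z ^ 3 * |z| ^ ((p - 1) - 2) = signedPow z p := fun z => by
    rw [← pow_three_mul_abs_rpow_eq_signedPow]; congr 2; ring
  have hS := integral_kernel_swap μ (a := p - 1) (by linarith) (by linarith)
    (w := fun z => z ^ 3) (by fun_prop) (by simp)
    (by simpa only [e] using integrable_signedPow hp)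
  simp only [e] at hS
  rw [← hS, ← (integral_rpow_mul_laplace (by linarith) h).2]
  refine setIntegral_congr_fun measurableSet_Ioi fun t ht => ?_
  have ht0 : 0 < t := ht
  obtain ⟨e1, e2⟩ := laplace_im_charFun μ ht
  have e3 : IntegrableOn (fun r => r * Real.exp (-(r * t))) (Ioi 0) := by
    have := integrableOn_rpow_mul_exp_neg_mul_rpow (s := 1) (p := 1) (by norm_num) one_pos ht0
    simpa [mul_comm] using this
  have e4 : ∫ r in Ioi (0 : ℝ), r * Real.exp (-(r * t)) = 1 / t ^ 2 := by
    have := Real.integral_rpow_mul_exp_neg_mul_Ioi two_pos ht0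
    norm_num at this
    simpa [mul_comm] using this
  simp only [sub_mul, mul_assoc]
  rw [integral_sub (e3.const_mul _) e1, e2, integral_const_mul, e4,
    show p - 1 - 1 = p - (2 : ℕ) by push_cast; ring, Real.rpow_sub_natCast ht0.ne']
  -- Removing the mean uses z/t² - z/(t² + z²) = z³/(t²(t² + z²)); hence the weight z³ with a = p -
  -- 1.
  have e5 : ∫ z, z ^ 3 / (t ^ 2 + z ^ 2) ∂μ
      = (∫ z, z ∂μ) - t ^ 2 * ∫ z, z / (t ^ 2 + z ^ 2) ∂μ := by
    have : ∀ z, z ^ 3 / (t ^ 2 + z ^ 2) = z - t ^ 2 * (z / (t ^ 2 + z ^ 2)) := fun z => by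
      have : t ^ 2 + z ^ 2 ≠ 0 := by positivity
      field_simp; ring
    simp_rw [this]
    rw [integral_sub hid ((integrable_id_div_sq_add_sq μ ht0).const_mul _), integral_const_mul]
  rw [e5]; field_simp

/-- The derivative of the characteristic function at 0 is i times the mean. This is what identifies
the mean of a stable law. -/
theorem tendsto_im_charFun_div (μ : Measure ℝ) [IsProbabilityMeasure μ]
    (hid : Integrable (fun z => z) μ) :
    Tendsto (fun r => (charFun μ r).im / r) (𝓝[>] 0) (𝓝 (∫ z, z ∂μ)) := by
  have hL : MemLp id (1 : ℕ) μ := by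
    exact_mod_cast memLp_one_iff_integrable.2 hid
  have hd : HasDerivAt (charFun μ) (Complex.I * ((∫ z, z ∂μ : ℝ) : ℂ)) 0 := by
    have h1 := iteratedDeriv_charFun_zero hL
    rw [iteratedDeriv_one] at h1
    simp only [pow_one] at h1
    rw [← h1]
    exact ((contDiff_charFun hL).differentiable (by simp)).differentiableAt.hasDerivAt
  have him := (Complex.imCLM.hasFDerivAt.comp_hasDerivAt (0 : ℝ) hd)
  have := him.tendsto_slope.mono_left (nhdsWithin_mono (0 : ℝ) (show Ioi (0 : ℝ) ⊆ {0}ᶜ from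
    fun x hx => ne_of_gt hx))
  refine (this.congr fun r => ?_).trans_eq ?_
  · simp [slope_def_field]
  · simp

/-! ### Bounds on the phase and convergence of g and g̃. -/

theorem measurable_stableEta (α : ℝ) : Measurable (fun u => stableEta u α) := by
  have := measurable_realSign
  unfold stableEta
  split_ifs <;> fun_prop

theorem rpow_le_rpow_add_rpow {r a s b : ℝ} (hr : 0 < r) (h1 : a ≤ s) (h2 : s ≤ b) :
    r ^ s ≤ r ^ a + r ^ b := by
  have ha : 0 < r ^ a := by positivity
  have hb : 0 < r ^ b := by positivity
  rcases le_total r 1 with h | h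
  · linarith [Real.rpow_le_rpow_of_exponent_ge hr h h1]
  · linarith [Real.rpow_le_rpow_of_exponent_le h h2]

theorem abs_log_le_rpow_add_rpow {r ε : ℝ} (hr : 0 < r) (hε : 0 < ε) :
    |Real.log r| ≤ (r ^ ε + r ^ (-ε)) / ε := by
  have h1 := Real.log_le_rpow_div hr.le hε
  have h2 := Real.log_le_rpow_div (inv_pos.2 hr).le hε
  rw [Real.log_inv, Real.inv_rpow hr.le, ← Real.rpow_neg hr.le] at h2
  have ha : 0 < r ^ ε / ε := by positivity
  have hb : 0 < r ^ (-ε) / ε := by positivity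
  rw [add_div]
  exact abs_le.2 ⟨by linarith, by linarith⟩

theorem abs_stableEta_le_of_ne_one {α : ℝ} (hα : α ≠ 1) {r : ℝ} (hr : 0 < r) :
    |stableEta r α| ≤ |Real.tan (Real.pi * α / 2)| * r ^ α := by
  unfold stableEta
  rw [if_neg hα, Real.sign_of_pos hr, abs_of_pos hr, abs_mul, abs_mul,
    abs_of_pos (by positivity : 0 < r ^ α)]
  simp

/-- The exponent q governs the behaviour at 0 and can approach min(1, α); it is kept strictly below
1 so that α = 1, with its logarithm, is covered too. The power 2 only handles large r, where
e^{-r^α} absorbs it. -/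
theorem exists_abs_stableEta_le {α q : ℝ} (hα2 : α < 2)
    (hq0 : 0 < q) (hq1 : q < 1) (hqα : q < α) :
    ∃ C, 0 ≤ C ∧ ∀ r : ℝ, 0 < r → |stableEta r α| ≤ C * (r ^ q + r ^ (2 : ℝ)) := by
  by_cases hα : α = 1
  · have hpi := Real.pi_pos
    -- Taking ε = 1 - q in the logarithm bound turns r·r^{-ε} into r^q.
    have hε : 0 < 1 - q := by linarith
    refine ⟨(2 / Real.pi) * (2 / (1 - q)), by positivity, fun r hr => ?_⟩
    have hl := abs_log_le_rpow_add_rpow hr hε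
    have e1 : r * r ^ (1 - q) = r ^ (2 - q) := by
      rw [mul_comm, ← Real.rpow_add_one hr.ne']; ring_nf
    have e2 : r * r ^ (-(1 - q)) = r ^ q := by
      rw [mul_comm, ← Real.rpow_add_one hr.ne']; ring_nf
    have b1 := rpow_le_rpow_add_rpow hr (a := q) (s := 2 - q) (b := 2) (by linarith) (by linarith)
    have b0 : 0 < r ^ (2 : ℝ) := by positivity
    unfold stableEta
    rw [if_pos hα, abs_of_pos hr, abs_mul, abs_of_pos (by positivity : 0 < 2 / Real.pi * r),
      mul_assoc, mul_assoc]
    refine mul_le_mul_of_nonneg_left ?_ (by positivity)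
    calc r * |Real.log r| ≤ r * ((r ^ (1 - q) + r ^ (-(1 - q))) / (1 - q)) := by gcongr
      _ = (r ^ (2 - q) + r ^ q) / (1 - q) := by rw [← e1, ← e2]; ring
      _ ≤ (2 * (r ^ q + r ^ (2 : ℝ))) / (1 - q) := by gcongr; linarith
      _ = _ := by ring
  · refine ⟨|Real.tan (Real.pi * α / 2)|, abs_nonneg _, fun r hr => ?_⟩
    refine (abs_stableEta_le_of_ne_one hα hr).trans ?_
    gcongr
    exact rpow_le_rpow_add_rpow hr hqα.le hα2.le

/-- The phase `x r + β η(r, α)` of the standardized characteristic function. -/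
noncomputable def stablePhase (α β x r : ℝ) : ℝ := x * r + β * stableEta r α

theorem measurable_stablePhase (α β x : ℝ) : Measurable (stablePhase α β x) := by
  have := measurable_stableEta α
  unfold stablePhase
  fun_prop

theorem exists_abs_stablePhase_le {α q : ℝ} (β x : ℝ) (hα2 : α < 2)
    (hq0 : 0 < q) (hq1 : q < 1) (hqα : q < α) :
    ∃ C, 0 ≤ C ∧ ∀ r : ℝ, 0 < r → |stablePhase α β x r| ≤ C * (r ^ q + r ^ (2 : ℝ)) := by
  obtain ⟨C, hC, h⟩ := exists_abs_stableEta_le hα2 hq0 hq1 hqα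
  refine ⟨|x| + |β| * C, by positivity, fun r hr => ?_⟩
  have h1 := rpow_le_rpow_add_rpow hr (a := q) (s := 1) (b := 2) hq1.le (by norm_num)
  rw [Real.rpow_one] at h1
  calc |stablePhase α β x r| ≤ |x * r| + |β * stableEta r α| := abs_add_le _ _
    _ = |x| * r + |β| * |stableEta r α| := by rw [abs_mul, abs_mul, abs_of_pos hr]
    _ ≤ |x| * (r ^ q + r ^ (2 : ℝ)) + |β| * (C * (r ^ q + r ^ (2 : ℝ))) := by
      gcongr; exact h r hr
    _ = _ := by ring

theorem exists_sq_stablePhase_le {α q : ℝ} (β x : ℝ) (hα2 : α < 2)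
    (hq0 : 0 < q) (hq1 : q < 1) (hqα : q < α) :
    ∃ C, 0 ≤ C ∧ ∀ r : ℝ, 0 < r → stablePhase α β x r ^ 2 ≤ C * (r ^ (2 * q) + r ^ (4 : ℝ)) := by
  obtain ⟨C, hC, h⟩ := exists_abs_stablePhase_le β x hα2 hq0 hq1 hqα
  refine ⟨2 * C ^ 2, by positivity, fun r hr => ?_⟩
  have e1 : r ^ (2 * q) = (r ^ q) ^ 2 := by
    rw [mul_comm, Real.rpow_mul hr.le, Real.rpow_two]
  have e2 : r ^ (4 : ℝ) = (r ^ (2 : ℝ)) ^ 2 := by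
    rw [← Real.rpow_two, ← Real.rpow_mul hr.le]; norm_num
  rw [e1, e2, ← sq_abs]
  calc |stablePhase α β x r| ^ 2 ≤ (C * (r ^ q + r ^ (2 : ℝ))) ^ 2 := by gcongr; exact h r hr
    _ ≤ _ := by nlinarith [mul_nonneg (sq_nonneg C) (sq_nonneg (r ^ q - r ^ (2 : ℝ)))]

/-- The cubic order at 0 is not needed: a quadratic bound suffices once 2q > p. The constant 2 comes
from y + 1 ≤ 2y² for y ≥ 1. -/
theorem abs_sin_sub_self_le (y : ℝ) : |Real.sin y - y| ≤ 2 * y ^ 2 := by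
  have key : ∀ y : ℝ, 0 < y → |Real.sin y - y| ≤ 2 * y ^ 2 := by
    intro y hy
    have h1 := Real.sin_le hy.le
    rw [abs_of_nonpos (by linarith)]
    rcases le_total y 1 with h | h
    · have := Real.sin_gt_sub_cube hy
      nlinarith [mul_nonneg (sq_nonneg y) (sub_nonneg.2 h)]
    · nlinarith [Real.neg_one_le_sin y]
  rcases lt_trichotomy y 0 with h | rfl | h
  · have := key (-y) (by linarith)
    rw [Real.sin_neg, ← abs_neg] at this
    convert this using 1
    · congr 1; ring
    · ring
  · simp
  · exact key y h

/-- Subtracting x r rather than the whole phase leaves βη, of order r^α, besides the quadratic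
error; so integrability against r^{-p-1} at 0 needs p < α as well as p < 2q. -/
theorem exists_abs_sin_stablePhase_sub_le {α q : ℝ} (β x : ℝ) (hα : α ≠ 1) (hα2 : α < 2)
    (hq0 : 0 < q) (hq1 : q < 1) (hqα : q < α) :
    ∃ C, 0 ≤ C ∧ ∀ r : ℝ, 0 < r → |Real.sin (stablePhase α β x r) - x * r|
      ≤ C * (r ^ (2 * q) + r ^ (4 : ℝ)) + C * (r ^ α + r ^ α) := by
  obtain ⟨C, hC, h⟩ := exists_sq_stablePhase_le β x hα2 hq0 hq1 hqα
  set D := |β| * |Real.tan (Real.pi * α / 2)|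
  have hD : 0 ≤ D := by positivity
  refine ⟨2 * C + D, by positivity, fun r hr => ?_⟩
  have h1 : |β * stableEta r α| ≤ D * r ^ α := by
    rw [abs_mul, mul_assoc]
    gcongr
    exact abs_stableEta_le_of_ne_one hα hr
  have h2 : Real.sin (stablePhase α β x r) - x * r
      = (Real.sin (stablePhase α β x r) - stablePhase α β x r) + β * stableEta r α := by
    unfold stablePhase; ring
  have p1 : 0 < r ^ (2 * q) + r ^ (4 : ℝ) := by positivity
  have p2 : 0 < r ^ α := by positivity
  rw [h2]
  refine (abs_add_le _ _).trans ?_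
  have h3 := abs_sin_sub_self_le (stablePhase α β x r)
  nlinarith [h r hr, mul_nonneg hD p1.le, mul_nonneg hD p2.le, mul_nonneg hC p2.le]

theorem integrableOn_mul_rpow_mul_exp_neg_rpow {α p a b C : ℝ} {f : ℝ → ℝ} (hα : 0 < α)
    (hf : Measurable f) (hpa : p < a) (hpb : p < b)
    (hb : ∀ r : ℝ, 0 < r → |f r| ≤ C * (r ^ a + r ^ b)) :
    IntegrableOn (fun r => f r * r ^ (-p - 1) * Real.exp (-r ^ α)) (Ioi 0) := by
  have h1 := ((integrableOn_rpow_mul_exp_neg_rpow (s := a - p - 1) (p := α) (by linarith) hα).add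
    (integrableOn_rpow_mul_exp_neg_rpow (s := b - p - 1) (p := α) (by linarith) hα)).const_mul C
  refine Integrable.mono' h1 (Measurable.aestronglyMeasurable (by fun_prop)) ?_
  filter_upwards [ae_restrict_mem measurableSet_Ioi] with r hr
  have hr0 : 0 < r := hr
  rw [mul_assoc, norm_mul, Real.norm_eq_abs,
    Real.norm_of_nonneg (by positivity : 0 ≤ r ^ (-p - 1) * Real.exp (-r ^ α))]
  calc _ ≤ C * (r ^ a + r ^ b) * (r ^ (-p - 1) * Real.exp (-r ^ α)) := by
        gcongr; exact hb r hr0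
    _ = _ := by
        simp only [Pi.add_apply]
        rw [show a - p - 1 = a + (-p - 1) by ring, show b - p - 1 = b + (-p - 1) by ring,
          Real.rpow_add hr0, Real.rpow_add hr0]
        ring

theorem integrableOn_gIntegrand {α β p x : ℝ} (hα0 : 0 < α) (hα2 : α < 2) (hp : p < α) :
    IntegrableOn (gIntegrand α β (-p) x) (Ioi 0) := by
  have hm := measurable_stablePhase α β x
  rcases lt_or_ge p 0 with h0 | h0
  · have := integrableOn_mul_rpow_mul_exp_neg_rpow (α := α) (p := p) (a := 0) (b := 0) (C := 1)
      (f := fun r => Real.cos (stablePhase α β x r)) hα0 (by fun_prop) h0 h0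
      (fun r hr => by
        have := Real.abs_cos_le_one (stablePhase α β x r)
        simp only [Real.rpow_zero]; linarith)
    refine this.congr_fun (fun r _ => ?_) measurableSet_Ioi
    simp [gIntegrand, h0, stablePhase]
  -- Since 1 - cos θ is at most θ²/2, of order r^{2q}, only q > p/2 is required.
  · obtain ⟨q, hq, hq'⟩ : ∃ q, p / 2 < q ∧ q < min 1 α :=
      exists_between (lt_min (by linarith) (by linarith))
    have hq0 : 0 < q := by linarith
    obtain ⟨C, hC, h⟩ := exists_sq_stablePhase_le β x hα2 hq0 (lt_min_iff.1 hq').1 (lt_min_iff.1 hq').2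
    have := integrableOn_mul_rpow_mul_exp_neg_rpow (α := α) (p := p) (a := 2 * q) (b := 4) (C := C)
      (f := fun r => Real.cos (stablePhase α β x r) - 1) hα0 (by fun_prop)
      (by linarith) (by linarith) (fun r hr => by
        have h1 := Real.one_sub_sq_div_two_le_cos (x := stablePhase α β x r)
        have h2 := Real.cos_le_one (stablePhase α β x r)
        rw [abs_of_nonpos (by linarith)]
        nlinarith [h r hr, sq_nonneg (stablePhase α β x r)])
    refine this.congr_fun (fun r _ => ?_) measurableSet_Ioi
    simp [gIntegrand, not_lt.2 h0, stablePhase]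

theorem integrableOn_gtIntegrand {α β p x : ℝ} (hα0 : 0 < α) (hα2 : α < 2) (hp : p < α) :
    IntegrableOn (gtIntegrand α β (-p) x) (Ioi 0) := by
  have hm := measurable_stablePhase α β x
  by_cases h1 : p < min 1 α
  · obtain ⟨q, hq, hq'⟩ : ∃ q, max p 0 < q ∧ q < min 1 α :=
      exists_between (max_lt h1 (lt_min one_pos hα0))
    have hpq : p < q := (le_max_left _ _).trans_lt hq
    have hq0 : 0 < q := (le_max_right _ _).trans_lt hq
    obtain ⟨C, hC, h⟩ := exists_abs_stablePhase_le β x hα2 hq0 (lt_min_iff.1 hq').1 (lt_min_iff.1 hq').2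
    have := integrableOn_mul_rpow_mul_exp_neg_rpow (α := α) (p := p) (a := q) (b := 2) (C := C)
      (f := fun r => Real.sin (stablePhase α β x r)) hα0 (by fun_prop)
      hpq (by linarith [(lt_min_iff.1 hq').1]) (fun r hr => Real.abs_sin_le_abs.trans (h r hr))
    refine this.congr_fun (fun r _ => ?_) measurableSet_Ioi
    have : -(min 1 α) < -p := by linarith
    simp only [gtIntegrand, if_pos this, stablePhase]
  · have hp1 : 1 ≤ p := by
      by_contra h
      exact h1 (lt_min (not_le.1 h) hp)
    -- The midpoint of p/2 and 1 satisfies both 2q > p and q < 1, because p < 2.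
    obtain ⟨C, hC, h⟩ := exists_abs_sin_stablePhase_sub_le (q := (p / 2 + 1) / 2) β x
      (by linarith : 1 < α).ne' hα2 (by linarith) (by linarith) (by linarith)
    set f : ℝ → ℝ := fun r => Real.sin (stablePhase α β x r) - x * r
    have hf : Measurable f := by fun_prop
    have h2 := ((integrableOn_rpow_mul_exp_neg_rpow (s := 2 * ((p / 2 + 1) / 2) - p - 1) (p := α)
      (by linarith) hα0).add
      (integrableOn_rpow_mul_exp_neg_rpow (s := 4 - p - 1) (p := α) (by linarith) hα0)).const_mul C
    have h3 := ((integrableOn_rpow_mul_exp_neg_rpow (s := α - p - 1) (p := α)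
      (by linarith) hα0).add
      (integrableOn_rpow_mul_exp_neg_rpow (s := α - p - 1) (p := α) (by linarith) hα0)).const_mul C
    have : IntegrableOn (fun r => f r * r ^ (-p - 1) * Real.exp (-r ^ α)) (Ioi 0) := by
      refine Integrable.mono' (h2.add h3) (Measurable.aestronglyMeasurable (by fun_prop)) ?_
      filter_upwards [ae_restrict_mem measurableSet_Ioi] with r hr
      have hr0 : 0 < r := hr
      rw [mul_assoc, norm_mul, Real.norm_eq_abs,
        Real.norm_of_nonneg (by positivity : 0 ≤ r ^ (-p - 1) * Real.exp (-r ^ α))]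
      refine (mul_le_mul_of_nonneg_right (h r hr0) (by positivity)).trans_eq ?_
      simp only [Pi.add_apply]
      have e : ∀ s, s - p - 1 = s + (-p - 1) := fun s => by ring
      simp only [e, Real.rpow_add hr0]
      ring
    refine this.congr_fun (fun r _ => ?_) measurableSet_Ioi
    have h5 : ¬ -(min 1 α) < -p := fun h => h1 (by linarith)
    simp only [gtIntegrand, if_neg h5, stablePhase, f]

/-! ### The Gamma term and continuity of moments in the order. -/

/-- The integral `∫₀^∞ (1 - exp(-r^α)) r^(-p-1) dr` for `0 < p < α`. -/
theorem integral_one_sub_exp_neg_rpow {α p : ℝ} (hp : 0 < p) (hpα : p < α) :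
    IntegrableOn (fun r => (1 - Real.exp (-r ^ α)) * r ^ (-p - 1)) (Ioi 0) ∧
    ∫ r in Ioi (0 : ℝ), (1 - Real.exp (-r ^ α)) * r ^ (-p - 1)
      = Real.Gamma (1 - p / α) / p := by
  have hα : 0 < α := hp.trans hpα
  -- Write 1 - e^{-r^α} as ∫₀¹ r^α e^{-s r^α} ds and swap; the r-integral is a Gamma value times
  -- s^{p/α-1}.
  let f : ℝ → ℝ → ℝ := fun s r => r ^ (α - p - 1) * Real.exp (-s * r ^ α)
  have hslice : ∀ s ∈ Ioc (0 : ℝ) 1, ∫ r in Ioi (0 : ℝ), f s r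
      = s ^ (p / α - 1) * ((1 / α) * Real.Gamma (1 - p / α)) := by
    intro s hs
    simp only [f]
    rw [integral_rpow_mul_exp_neg_mul_rpow hα (by linarith) hs.1,
      show -(α - p - 1 + 1) / α = p / α - 1 by field_simp; ring,
      show (α - p - 1 + 1) / α = 1 - p / α by field_simp; ring]
    ring
  have hexp : -1 < p / α - 1 := by linarith [div_pos hp hα]
  have hint : IntegrableOn (fun s : ℝ => s ^ (p / α - 1)) (Ioc 0 1) :=
    (intervalIntegrable_iff_integrableOn_Ioc_of_le zero_le_one).1
      (intervalIntegral.intervalIntegrable_rpow' hexp)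
  have hI : Integrable (Function.uncurry f)
      ((volume.restrict (Ioc (0 : ℝ) 1)).prod (volume.restrict (Ioi (0 : ℝ)))) := by
    refine integrable_uncurry_of_nonneg (Measurable.aestronglyMeasurable ?_) ?_ ?_ ?_
    · unfold f Function.uncurry; fun_prop
    · filter_upwards with s
      filter_upwards [ae_restrict_mem measurableSet_Ioi] with r hr
      have := mem_Ioi.1 hr
      positivity
    · filter_upwards [ae_restrict_mem measurableSet_Ioc] with s hs
      exact integrableOn_rpow_mul_exp_neg_mul_rpow (by linarith) hα hs.1
    · exact IntegrableOn.congr_fun (hint.mul_const _) (fun s hs => (hslice s hs).symm)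
        measurableSet_Ioc
  have hslice' : ∀ r ∈ Ioi (0 : ℝ), ∫ s in Ioc (0 : ℝ) 1, f s r
      = (1 - Real.exp (-r ^ α)) * r ^ (-p - 1) := by
    intro r hr
    have hr0 : 0 < r := hr
    have hrα : 0 < r ^ α := by positivity
    have hd : ∀ s ∈ uIcc (0 : ℝ) 1,
        HasDerivAt (fun s : ℝ => -(r ^ (-p - 1) * Real.exp (-s * r ^ α))) (f s r) s := by
      intro s _
      have h1 : HasDerivAt (fun s : ℝ => -s * r ^ α) (-1 * r ^ α) s :=
        ((hasDerivAt_id s).neg).mul_const _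
      refine ((h1.exp.const_mul (r ^ (-p - 1))).neg).congr_deriv ?_
      simp only [f]
      rw [show α - p - 1 = α + (-p - 1) by ring, Real.rpow_add hr0]
      ring
    rw [← intervalIntegral.integral_of_le zero_le_one,
      intervalIntegral.integral_eq_sub_of_hasDerivAt hd
        (Continuous.intervalIntegrable (by unfold f; fun_prop) _ _)]
    simp
    ring
  constructor
  · refine Integrable.congr hI.integral_prod_right ?_
    filter_upwards [ae_restrict_mem measurableSet_Ioi] with r hr
    exact hslice' r hr
  · rw [← setIntegral_congr_fun measurableSet_Ioi hslice', ← integral_integral_swap hI,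
      setIntegral_congr_fun measurableSet_Ioc hslice, integral_mul_const,
      ← intervalIntegral.integral_of_le zero_le_one, integral_rpow (Or.inl hexp)]
    have : p / α - 1 + 1 = p / α := by ring
    rw [this, Real.one_rpow, Real.zero_rpow (by positivity)]
    field_simp
    ring

/-- Dominated convergence with majorant |z|^a + |z|^b. The point z = 0 must be null because p ↦ 0^p
is discontinuous at p = 0. -/
theorem tendsto_integral_mul_abs_rpow (μ : Measure ℝ) {a b p₀ : ℝ} {w : ℝ → ℝ}
    (hw : Measurable w) (hw1 : ∀ z, |w z| ≤ 1) (hne : ∀ᵐ z ∂μ, z ≠ 0)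
    (ha : Integrable (fun z => |z| ^ a) μ) (hb : Integrable (fun z => |z| ^ b) μ)
    (h1 : a < p₀) (h2 : p₀ < b) :
    Tendsto (fun p => ∫ z, w z * |z| ^ p ∂μ) (𝓝 p₀) (𝓝 (∫ z, w z * |z| ^ p₀ ∂μ)) := by
  refine tendsto_integral_filter_of_dominated_convergence (fun z => |z| ^ a + |z| ^ b) ?_ ?_
    (ha.add hb) ?_
  · exact Eventually.of_forall fun p => Measurable.aestronglyMeasurable (by fun_prop)
  · filter_upwards [Ioo_mem_nhds h1 h2] with p hp
    filter_upwards [hne] with z hz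
    have hz' := abs_pos.2 hz
    rw [norm_mul, Real.norm_of_nonneg (by positivity : 0 ≤ |z| ^ p), Real.norm_eq_abs]
    calc _ ≤ 1 * |z| ^ p := by gcongr; exact hw1 z
      _ ≤ _ := by rw [one_mul]; exact rpow_le_rpow_add_rpow hz' hp.1.le hp.2.le
  · filter_upwards [hne] with z hz
    have : ContinuousAt (fun p : ℝ => |z| ^ p) p₀ :=
      Real.continuousAt_const_rpow (abs_ne_zero.2 hz)
    exact this.const_mul (w z)

/-! ### Moments of the stable law of unit scale. -/

/-- `μ` is the stable law with unit scale and location `d`, on the level of the characteristic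
function on the positive half-line. -/
structure IsStandardStable (μ : Measure ℝ) (α β d : ℝ) : Prop where
  re_charFun : ∀ r : ℝ, 0 < r →
    (charFun μ r).re = Real.cos (stablePhase α β (-d) r) * Real.exp (-r ^ α)
  im_charFun : ∀ r : ℝ, 0 < r →
    (charFun μ r).im = -(Real.sin (stablePhase α β (-d) r) * Real.exp (-r ^ α))

theorem eq_of_mul_pi_div_two_mul {M s T : ℝ} (hs : s ≠ 0) (h : M * (Real.pi / (2 * s)) = T) :
    M = 2 * T / Real.pi * s := by
  have := Real.pi_ne_zero
  rw [← h]; field_simp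

namespace IsStandardStable

variable {μ : Measure ℝ} [IsProbabilityMeasure μ] {α β d : ℝ}

theorem absMoment_neg (hμ : IsStandardStable μ α β d) (hα0 : 0 < α) (hα2 : α < 2) {p : ℝ}
    (hp1 : -1 < p) (hp0 : p < 0) :
    (∀ᵐ z ∂μ, z ≠ 0) ∧ Integrable (fun z => |z| ^ p) μ ∧
      ∫ z, |z| ^ p ∂μ = 2 * Real.Gamma (p + 1) / Real.pi * Real.sin (Real.pi * p / 2) *
        (-gFun α β (-p) (-d)) := by
  have e : ∀ r ∈ Ioi (0 : ℝ), gIntegrand α β (-p) (-d) r = (charFun μ r).re * r ^ (-p - 1) := by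
    intro r hr
    rw [hμ.re_charFun r hr]
    simp only [gIntegrand, if_pos (neg_pos.2 hp0), stablePhase]
    ring
  have hi := integrableOn_gIntegrand (β := β) (x := -d) hα0 hα2 (hp0.trans hα0)
  obtain ⟨h1, h2, h3⟩ := absMoment_neg_of_charFun μ hp1 hp0 (hi.congr_fun e measurableSet_Ioi)
  refine ⟨h1, h2, ?_⟩
  have hs := sin_pi_mul_div_two_pos (a := p + 2) (by linarith) (by linarith)
  rw [eq_of_mul_pi_div_two_mul hs.ne' h3, ← setIntegral_congr_fun measurableSet_Ioi e,
    show Real.pi * (p + 2) / 2 = Real.pi * p / 2 + Real.pi by ring, Real.sin_add_pi, gFun]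
  ring

theorem absMoment_pos (hμ : IsStandardStable μ α β d) (hα0 : 0 < α) (hα2 : α < 2) {p : ℝ}
    (hp0 : 0 < p) (hpα : p < α) :
    Integrable (fun z => |z| ^ p) μ ∧
      ∫ z, |z| ^ p ∂μ = 2 * Real.Gamma (p + 1) / Real.pi * Real.sin (Real.pi * p / 2) *
        (Real.Gamma (1 - p / α) / p - gFun α β (-p) (-d)) := by
  -- This is 1 - e cos θ = (1 - e) - (cos θ - 1)e with e = e^{-r^α}.
  have e : ∀ r ∈ Ioi (0 : ℝ), (1 - Real.exp (-r ^ α)) * r ^ (-p - 1) - gIntegrand α β (-p) (-d) r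
      = (1 - (charFun μ r).re) * r ^ (-p - 1) := by
    intro r hr
    rw [hμ.re_charFun r hr]
    simp only [gIntegrand, if_neg (by linarith : ¬ 0 < -p), stablePhase]
    ring
  have hi := integrableOn_gIntegrand (β := β) (x := -d) hα0 hα2 hpα
  obtain ⟨hj, hj'⟩ := integral_one_sub_exp_neg_rpow hp0 hpα
  obtain ⟨h2, h3⟩ := absMoment_pos_of_charFun μ hp0 (hpα.trans hα2)
    (IntegrableOn.congr_fun (hj.sub hi) e measurableSet_Ioi)
  refine ⟨h2, ?_⟩
  have hs := sin_pi_mul_div_two_pos hp0 (hpα.trans hα2)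
  rw [eq_of_mul_pi_div_two_mul hs.ne' h3, ← setIntegral_congr_fun measurableSet_Ioi e,
    integral_sub hj hi, hj', gFun]
  ring

theorem ae_ne_zero (hμ : IsStandardStable μ α β d) (hα0 : 0 < α) (hα2 : α < 2) :
    ∀ᵐ z ∂μ, z ≠ 0 :=
  (hμ.absMoment_neg hα0 hα2 (p := -1 / 2) (by norm_num) (by norm_num)).1

theorem integrable_abs_rpow (hμ : IsStandardStable μ α β d) (hα0 : 0 < α) (hα2 : α < 2) {p : ℝ}
    (hp1 : -1 < p) (hpα : p < α) : Integrable (fun z => |z| ^ p) μ := by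
  rcases lt_trichotomy p 0 with h | rfl | h
  · exact (hμ.absMoment_neg hα0 hα2 hp1 h).2.1
  · simp
  · exact (hμ.absMoment_pos hα0 hα2 h hpα).1

theorem absMoment (hμ : IsStandardStable μ α β d) (hα0 : 0 < α) (hα2 : α < 2) {p : ℝ}
    (hp1 : -1 < p) (hpα : p < α) (hp0 : p ≠ 0) :
    ∫ z, |z| ^ p ∂μ = 2 * Real.Gamma (p + 1) / Real.pi * Real.sin (Real.pi * p / 2) *
        ((if 0 < p then Real.Gamma (1 - p / α) / p else 0) - gFun α β (-p) (-d)) := by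
  rcases hp0.lt_or_gt with h | h
  · rw [if_neg h.not_gt, (hμ.absMoment_neg hα0 hα2 hp1 h).2.2, zero_sub]
  · rw [if_pos h, (hμ.absMoment_pos hα0 hα2 h hpα).2]

theorem integrable_id (hμ : IsStandardStable μ α β d) (hα1 : 1 < α) (hα2 : α < 2) :
    Integrable (fun z => z) μ := by
  have := hμ.integrable_abs_rpow (p := 1) (by linarith) hα2 (by norm_num) hα1
  simp only [Real.rpow_one] at this
  exact (integrable_norm_iff measurable_id.aestronglyMeasurable).1 this

/-- For α > 1 the term βη is o(r), so Im φ(r)/r tends to d. -/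
theorem integral_id (hμ : IsStandardStable μ α β d) (hα1 : 1 < α) (hα2 : α < 2) :
    ∫ z, z ∂μ = d := by
  refine tendsto_nhds_unique (tendsto_im_charFun_div μ (hμ.integrable_id hα1 hα2)) ?_
  -- Any q between 1/2 and 1 would do: after division by r the exponent 2q - 1 must be positive.
  obtain ⟨C, hC, h⟩ := exists_abs_sin_stablePhase_sub_le (q := 3 / 4) β (-d) hα1.ne' hα2
    (by norm_num) (by norm_num) (by linarith)
  have hpow : ∀ s : ℝ, 0 < s → Tendsto (fun r : ℝ => r ^ s) (𝓝[>] 0) (𝓝 0) := by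
    intro s hs
    have := (Real.continuous_rpow_const hs.le).tendsto (0 : ℝ)
    rw [Real.zero_rpow hs.ne'] at this
    exact this.mono_left nhdsWithin_le_nhds
  have hsin : Tendsto (fun r => Real.sin (stablePhase α β (-d) r) / r) (𝓝[>] 0) (𝓝 (-d)) := by
    rw [tendsto_iff_norm_sub_tendsto_zero]
    have hlim : Tendsto (fun r : ℝ => C * (r ^ (1 / 2 : ℝ) + r ^ (3 : ℝ))
        + C * (r ^ (α - 1) + r ^ (α - 1))) (𝓝[>] 0) (𝓝 0) := by
      have := (((hpow (1 / 2) (by norm_num)).add (hpow 3 (by norm_num))).const_mul C).add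
        (((hpow (α - 1) (by linarith)).add (hpow (α - 1) (by linarith))).const_mul C)
      simpa using this
    refine squeeze_zero' (Eventually.of_forall fun r => norm_nonneg _) ?_ hlim
    filter_upwards [self_mem_nhdsWithin] with r hr
    have hr0 : 0 < r := hr
    have e : Real.sin (stablePhase α β (-d) r) / r - -d
        = (Real.sin (stablePhase α β (-d) r) - -d * r) / r := by field_simp
    rw [e, Real.norm_eq_abs, abs_div, abs_of_pos hr0, div_le_iff₀ hr0]
    refine (h r hr0).trans_eq ?_
    have e1 : r ^ (2 * (3 / 4) : ℝ) = r ^ (1 / 2 : ℝ) * r := by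
      rw [← Real.rpow_add_one hr0.ne']; norm_num
    have e2 : r ^ (4 : ℝ) = r ^ (3 : ℝ) * r := by
      rw [← Real.rpow_add_one hr0.ne']; norm_num
    have e3 : r ^ α = r ^ (α - 1) * r := by
      rw [← Real.rpow_add_one hr0.ne']; ring_nf
    rw [e1, e2, e3]; ring
  have hexp : Tendsto (fun r : ℝ => Real.exp (-r ^ α)) (𝓝[>] 0) (𝓝 1) := by
    have := (Real.continuous_exp.tendsto _).comp (hpow α (by linarith)).neg
    simpa [Function.comp_def] using this
  have := (hsin.mul hexp).neg
  simp only [neg_neg, mul_one] at this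
  refine this.congr' ?_
  filter_upwards [self_mem_nhdsWithin] with r hr
  rw [hμ.im_charFun r hr]
  ring

theorem signedMoment_of_lt_one (hμ : IsStandardStable μ α β d) (hα0 : 0 < α) (hα2 : α < 2) {p : ℝ}
    (hp1 : -1 < p) (hpα : p < α) (hp : p < 1) :
    ∫ z, signedPow z p ∂μ = 2 * Real.Gamma (p + 1) / Real.pi * Real.cos (Real.pi * p / 2) *
        (-gtFun α β (-p) (-d)) := by
  have hmin : -(min 1 α) < -p := neg_lt_neg (lt_min hp hpα)
  have e : ∀ r ∈ Ioi (0 : ℝ), -gtIntegrand α β (-p) (-d) r = (charFun μ r).im * r ^ (-p - 1) := by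
    intro r hr
    rw [hμ.im_charFun r hr]
    simp only [gtIntegrand, if_pos hmin, stablePhase]
    ring
  have hi := integrableOn_gtIntegrand (β := β) (x := -d) hα0 hα2 hpα
  have h3 := signedMoment_of_charFun μ hp1 hp (hμ.integrable_abs_rpow hα0 hα2 hp1 hpα)
    (IntegrableOn.congr_fun hi.neg e measurableSet_Ioi)
  have hs := sin_pi_mul_div_two_pos (a := p + 1) (by linarith) (by linarith)
  rw [eq_of_mul_pi_div_two_mul hs.ne' h3, ← setIntegral_congr_fun measurableSet_Ioi e,
    integral_neg, show Real.pi * (p + 1) / 2 = Real.pi * p / 2 + Real.pi / 2 by ring,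
    Real.sin_add_pi_div_two, gtFun]
  ring

theorem signedMoment_of_one_lt (hμ : IsStandardStable μ α β d) (hα2 : α < 2) {p : ℝ}
    (hp : 1 < p) (hpα : p < α) :
    ∫ z, signedPow z p ∂μ = 2 * Real.Gamma (p + 1) / Real.pi * Real.cos (Real.pi * p / 2) *
        (d * Real.Gamma ((1 - p) / α) / α - gtFun α β (-p) (-d)) := by
  have hα0 : 0 < α := by linarith
  have hmin : ¬ -(min 1 α) < -p := by
    have := min_le_left 1 α
    intro h; linarith
  -- With e = e^{-r^α}, d r + e sin θ = d r(1 - e) + (sin θ + d r)e. The first summand is the Gamma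
  -- integral at order p - 1, the second the compensated g̃ integrand at x = -d.
  have e : ∀ r ∈ Ioi (0 : ℝ), d * ((1 - Real.exp (-r ^ α)) * r ^ (-(p - 1) - 1))
      + gtIntegrand α β (-p) (-d) r = ((∫ z, z ∂μ) * r - (charFun μ r).im) * r ^ (-p - 1) := by
    intro r hr
    have hr0 : 0 < r := hr
    rw [hμ.im_charFun r hr, hμ.integral_id (hp.trans hpα) hα2,
      show -(p - 1) - 1 = (-p - 1) + 1 by ring, Real.rpow_add_one hr0.ne']
    simp only [gtIntegrand, if_neg hmin, stablePhase]
    ring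
  have hi := integrableOn_gtIntegrand (β := β) (x := -d) hα0 hα2 hpα
  obtain ⟨hj, hj'⟩ := integral_one_sub_exp_neg_rpow (α := α) (p := p - 1) (by linarith)
    (by linarith)
  have h3 := signedMoment_of_charFun_of_one_lt μ hp (hpα.trans hα2)
    (hμ.integrable_abs_rpow hα0 hα2 (by linarith) hpα) (hμ.integrable_id (hp.trans hpα) hα2)
    (IntegrableOn.congr_fun ((hj.const_mul d).add hi) e measurableSet_Ioi)
  have hs := sin_pi_mul_div_two_pos (a := p - 1) (by linarith) (by linarith)
  have hG : Real.Gamma (1 - (p - 1) / α) / (p - 1) = -(Real.Gamma ((1 - p) / α) / α) := by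
    have hne : (1 - p) / α ≠ 0 := div_ne_zero (by linarith) hα0.ne'
    have hp' : p - 1 ≠ 0 := by linarith
    rw [show 1 - (p - 1) / α = (1 - p) / α + 1 by ring, Real.Gamma_add_one hne]
    field_simp
    ring
  rw [eq_of_mul_pi_div_two_mul hs.ne' h3, ← setIntegral_congr_fun measurableSet_Ioi e,
    integral_add (hj.const_mul d) hi, integral_const_mul, hj', hG,
    show Real.pi * (p - 1) / 2 = Real.pi * p / 2 - Real.pi / 2 by ring,
    Real.sin_sub_pi_div_two, gtFun]
  ring

theorem signedMoment (hμ : IsStandardStable μ α β d) (hα0 : 0 < α) (hα2 : α < 2) {p : ℝ}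
    (hp1 : -1 < p) (hpα : p < α) (hp : p ≠ 1) :
    ∫ z, signedPow z p ∂μ = 2 * Real.Gamma (p + 1) / Real.pi * Real.cos (Real.pi * p / 2) *
        ((if 1 < p then d * Real.Gamma ((1 - p) / α) / α else 0) - gtFun α β (-p) (-d)) := by
  rcases hp.lt_or_gt with h | h
  · rw [if_neg h.not_gt, hμ.signedMoment_of_lt_one hα0 hα2 hp1 hpα h, zero_sub]
  · rw [if_pos h, hμ.signedMoment_of_one_lt hα2 h hpα]

/-- The moments, not the closed expression, are passed to the limit; any window around 0 inside (-1,
α) serves. -/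
theorem tendsto_absMoment (hμ : IsStandardStable μ α β d) (hα0 : 0 < α) (hα2 : α < 2) :
    Tendsto (fun p : ℝ => ∫ z, |z| ^ p ∂μ) (𝓝 0) (𝓝 1) := by
  have := tendsto_integral_mul_abs_rpow μ (a := -1 / 2) (b := α / 2) (p₀ := 0) (w := fun _ => 1)
    measurable_const (by simp) (hμ.ae_ne_zero hα0 hα2)
    (hμ.integrable_abs_rpow hα0 hα2 (by norm_num) (by linarith))
    (hμ.integrable_abs_rpow hα0 hα2 (by linarith) (by linarith)) (by norm_num) (by linarith)
  simpa using this

theorem tendsto_signedMoment (hμ : IsStandardStable μ α β d) (hα1 : 1 < α) (hα2 : α < 2) :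
    Tendsto (fun p => ∫ z, signedPow z p ∂μ) (𝓝 1) (𝓝 d) := by
  have hα0 : 0 < α := by linarith
  have := tendsto_integral_mul_abs_rpow μ (a := 0) (b := (1 + α) / 2) (p₀ := 1) (w := Real.sign)
    measurable_realSign
    (fun z => by rcases Real.sign_apply_eq z with h | h | h <;> simp [h])
    (hμ.ae_ne_zero hα0 hα2)
    (hμ.integrable_abs_rpow hα0 hα2 (by norm_num) (by linarith))
    (hμ.integrable_abs_rpow hα0 hα2 (by linarith) (by linarith)) (by norm_num) (by linarith)
  have e : ∀ z : ℝ, Real.sign z * |z| ^ (1 : ℝ) = z := fun z => by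
    have h := mul_abs_rpow_eq_signedPow z 1
    rw [sub_self, Real.rpow_zero, mul_one] at h
    exact h.symm
  simp only [e, hμ.integral_id hα1 hα2] at this
  exact this

end IsStandardStable

/-! ### Reduction to unit scale and conclusion. -/

/-- η is homogeneous of degree α except at α = 1, where the logarithm leaves a linear term in r.
That term is the correction built into δ*. -/
theorem stableEta_inv_scale {α γ r : ℝ} (hγ : 0 < γ) (hr : 0 < r) :
    γ ^ α * stableEta (γ⁻¹ * r) α
      = stableEta r α - if α = 1 then (2 / Real.pi) * Real.log γ * r else 0 := by
  have hr' : 0 < γ⁻¹ * r := by positivity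
  unfold stableEta
  split_ifs with h
  · subst h
    rw [abs_of_pos hr', abs_of_pos hr, Real.log_mul (by positivity) hr.ne', Real.log_inv,
      Real.rpow_one]
    field_simp
    ring
  · rw [abs_of_pos hr', abs_of_pos hr, Real.sign_of_pos hr', Real.sign_of_pos hr,
      Real.mul_rpow (by positivity) hr.le, Real.inv_rpow hγ.le]
    have : γ ^ α ≠ 0 := by positivity
    field_simp
    simp

theorem isStandardStable_map {ν : Measure ℝ} {α β γ δ : ℝ} (hγ : 0 < γ)
    (hν : ∀ u : ℝ, charFun ν u = stableCharFun α β γ δ u) :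
    IsStandardStable (ν.map (γ⁻¹ * ·)) α β (deltaStar α β γ δ) := by
  have key : ∀ r : ℝ, 0 < r → charFun (ν.map (γ⁻¹ * ·)) r
      = Complex.exp (((-r ^ α : ℝ) : ℂ)
        + ((-stablePhase α β (-deltaStar α β γ δ) r : ℝ) : ℂ) * Complex.I) := by
    intro r hr
    have hr' : 0 < γ⁻¹ * r := by positivity
    rw [charFun_map_mul, hν, stableCharFun]
    congr 1
    have h1 : γ ^ α * |γ⁻¹ * r| ^ α = r ^ α := by
      rw [abs_of_pos hr', ← Real.mul_rpow hγ.le hr'.le, mul_inv_cancel_left₀ hγ.ne']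
    have h2 := stableEta_inv_scale (α := α) hγ hr
    have h3 : -(β * (γ ^ α * stableEta (γ⁻¹ * r) α)) + γ⁻¹ * r * δ
        = -stablePhase α β (-deltaStar α β γ δ) r := by
      rw [h2]
      unfold stablePhase deltaStar
      split_ifs <;> ring
    rw [← h1, ← h3]
    push_cast
    ring
  refine ⟨fun r hr => ?_, fun r hr => ?_⟩
  · rw [key r hr, Complex.exp_re]
    simp only [Complex.add_re, Complex.add_im, Complex.ofReal_re, Complex.ofReal_im,
      Complex.re_ofReal_mul, Complex.im_ofReal_mul, Complex.I_re, Complex.I_im, mul_zero, mul_one,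
      add_zero, zero_add, Real.cos_neg]
    ring
  · rw [key r hr, Complex.exp_im]
    simp only [Complex.add_re, Complex.add_im, Complex.ofReal_re, Complex.ofReal_im,
      Complex.re_ofReal_mul, Complex.im_ofReal_mul, Complex.I_re, Complex.I_im, mul_zero, mul_one,
      add_zero, zero_add, Real.sin_neg]
    ring

theorem abs_rpow_eq_scale {γ : ℝ} (hγ : 0 < γ) (x p : ℝ) :
    |x| ^ p = γ ^ p * |γ⁻¹ * x| ^ p := by
  rw [← Real.mul_rpow hγ.le (abs_nonneg _), abs_mul, abs_of_pos (inv_pos.2 hγ),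
    mul_inv_cancel_left₀ hγ.ne']

theorem signedPow_eq_scale {γ : ℝ} (hγ : 0 < γ) (x p : ℝ) :
    signedPow x p = γ ^ p * signedPow (γ⁻¹ * x) p := by
  rw [← mul_abs_rpow_eq_signedPow, ← mul_abs_rpow_eq_signedPow, abs_rpow_eq_scale hγ x,
    Real.rpow_sub_one hγ.ne']
  field_simp

theorem mainTheorem4 {Ω : Type*} [MeasurableSpace Ω] (P : Measure Ω) [IsProbabilityMeasure P]
    (X : Ω → ℝ) (α β γ δ : ℝ) (hα0 : 0 < α) (hα2 : α < 2) (hβ0 : -1 ≤ β) (hβ1 : β ≤ 1)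
    (hγ : 0 < γ) (hX : HasStableLaw X P α β γ δ) :
    (∀ p : ℝ, -1 < p → p < α →
      IntegrableOn (gIntegrand α β (-p) (-deltaStar α β γ δ)) (Ioi 0) ∧
      IntegrableOn (gtIntegrand α β (-p) (-deltaStar α β γ δ)) (Ioi 0) ∧
      Integrable (fun ω => |X ω| ^ p) P ∧
      Integrable (fun ω => signedPow (X ω) p) P ∧
      (p ≠ 0 → ∫ ω, |X ω| ^ p ∂P = absMomentExpr α β γ δ p) ∧
      (p ≠ 1 → ∫ ω, signedPow (X ω) p ∂P = signedMomentExpr α β γ δ p)) ∧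
    (∫ ω, |X ω| ^ (0 : ℝ) ∂P = 1 ∧
      Tendsto (fun p => absMomentExpr α β γ δ p) (𝓝[≠] 0) (𝓝 1)) ∧
    (1 < α →
      ∫ ω, signedPow (X ω) 1 ∂P = δ ∧
      Tendsto (fun p => signedMomentExpr α β γ δ p) (𝓝[≠] 1) (𝓝 δ)) := by
  have hXm := hX.aemeasurable
  have hP : IsProbabilityMeasure (P.map X) := Measure.isProbabilityMeasure_map hXm
  set μ : Measure ℝ := (P.map X).map (γ⁻¹ * ·)
  have hm : Measurable (fun x : ℝ => γ⁻¹ * x) := by fun_prop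
  have hμP : IsProbabilityMeasure μ := Measure.isProbabilityMeasure_map hm.aemeasurable
  have hμ : IsStandardStable μ α β (deltaStar α β γ δ) := isStandardStable_map hγ hX.charFun_eq
  have hmap : P.map (fun ω => γ⁻¹ * X ω) = μ := by
    exact (AEMeasurable.map_map_of_aemeasurable hm.aemeasurable hXm).symm
  have hZ : AEMeasurable (fun ω => γ⁻¹ * X ω) P := hXm.const_mul _
  have hint : ∀ f : ℝ → ℝ, Measurable f →
      (Integrable f μ → Integrable (fun ω => f (γ⁻¹ * X ω)) P) ∧
      ∫ ω, f (γ⁻¹ * X ω) ∂P = ∫ z, f z ∂μ := by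
    intro f hf
    rw [← hmap]
    exact ⟨fun h => h.comp_aemeasurable hZ, (integral_map hZ hf.aestronglyMeasurable).symm⟩
  have habs_meas : ∀ p : ℝ, Measurable (fun z : ℝ => |z| ^ p) := fun p => by fun_prop
  have habs : ∀ p : ℝ, ∫ ω, |X ω| ^ p ∂P = γ ^ p * ∫ z, |z| ^ p ∂μ := by
    intro p
    simp_rw [fun ω => abs_rpow_eq_scale hγ (X ω) p]
    rw [integral_const_mul, (hint _ (habs_meas p)).2]
  have hsgn : ∀ p, ∫ ω, signedPow (X ω) p ∂P = γ ^ p * ∫ z, signedPow z p ∂μ := by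
    intro p
    simp_rw [fun ω => signedPow_eq_scale hγ (X ω) p]
    rw [integral_const_mul, (hint _ (measurable_signedPow p)).2]
  have habsE : ∀ p, -1 < p → p < α → p ≠ 0 →
      absMomentExpr α β γ δ p = γ ^ p * ∫ z, |z| ^ p ∂μ := by
    intro p hp1 hpα hp
    rw [hμ.absMoment hα0 hα2 hp1 hpα hp, absMomentExpr]
    ring
  have hsgnE : ∀ p, -1 < p → p < α → p ≠ 1 →
      signedMomentExpr α β γ δ p = γ ^ p * ∫ z, signedPow z p ∂μ := by
    intro p hp1 hpα hp
    rw [hμ.signedMoment hα0 hα2 hp1 hpα hp, signedMomentExpr]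
    ring
  have hγc : ∀ p : ℝ, Tendsto (fun p : ℝ => γ ^ p) (𝓝 p) (𝓝 (γ ^ p)) := fun p =>
    Real.continuousAt_const_rpow hγ.ne'
  refine ⟨fun p hp1 hpα => ⟨integrableOn_gIntegrand hα0 hα2 hpα,
    integrableOn_gtIntegrand hα0 hα2 hpα, ?_, ?_, ?_, ?_⟩, ⟨by simp, ?_⟩, fun hα1 => ?_⟩
  · simp_rw [fun ω => abs_rpow_eq_scale hγ (X ω) p]
    exact ((hint _ (habs_meas p)).1 (hμ.integrable_abs_rpow hα0 hα2 hp1 hpα)).const_mul _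
  · simp_rw [fun ω => signedPow_eq_scale hγ (X ω) p]
    exact ((hint _ (measurable_signedPow p)).1
      (integrable_signedPow (hμ.integrable_abs_rpow hα0 hα2 hp1 hpα))).const_mul _
  · intro hp
    rw [habs, habsE p hp1 hpα hp]
  · intro hp
    rw [hsgn, hsgnE p hp1 hpα hp]
  -- On a punctured neighbourhood of 0 the closed expression equals γ^p times the moment of X/γ, so
  -- it inherits the limit.
  · have h := ((hγc 0).mul (hμ.tendsto_absMoment hα0 hα2)).mono_left
      (nhdsWithin_le_nhds (s := {0}ᶜ))
    rw [Real.rpow_zero, one_mul] at h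
    refine h.congr' ?_
    filter_upwards [self_mem_nhdsWithin,
      nhdsWithin_le_nhds (Ioo_mem_nhds neg_one_lt_zero hα0)] with p hp0 hp
    exact (habsE p hp.1 hp.2 hp0).symm
  · have h := hμ.tendsto_signedMoment hα1 hα2
    have hδ : γ ^ (1 : ℝ) * deltaStar α β γ δ = δ := by
      rw [deltaStar, if_neg hα1.ne', Real.rpow_one, mul_div_cancel₀ _ hγ.ne']
    have hone : ∀ z, signedPow z 1 = z := fun z => by
      simpa using (mul_abs_rpow_eq_signedPow z 1).symm
    refine ⟨?_, ?_⟩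
    · rw [hsgn]
      simp_rw [hone]
      rw [hμ.integral_id hα1 hα2, hδ]
    · have h2 := ((hγc 1).mul h).mono_left (nhdsWithin_le_nhds (s := {1}ᶜ))
      rw [hδ] at h2
      refine h2.congr' ?_
      filter_upwards [self_mem_nhdsWithin,
        nhdsWithin_le_nhds (Ioo_mem_nhds (by norm_num : (-1 : ℝ) < 1) hα1)] with p hp0 hp
      exact (hsgnE p hp.1 hp.2 hp0).symm
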